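/- Let $L>0$ and $\alpha\in\mathbb{R}$. For complex $s$ with $\operatorname{Re}s>0$ let $G(s)=\exp(-(Ls)^{\alpha})$, with the principal branch of the power (the fractional diffusive delay). A function $f:(0,\infty)\to\mathbb{C}$ is called an impulse response of $G$ if there is a real $c\ge 0$ such that for every $s\in\mathbb{C}$ with $\operatorname{Re}s>c$ the Laplace integral $\int_0^\infty e^{-st}f(t)\,dt$ converges absolutely and equals $G(s)$. Then $G$ has an impulse response if and only if $\alpha\in\,]0,1[$. Moreover, if $\alpha\in\,]0,1[$, then for every $t>0$ the series $$r(t)=\sum_{i=0}^{\infty}\frac{(-L^{\alpha})^{i}}{i!}\,\frac{t^{-\alpha i-1}}{\Gamma(-\alpha i)}$$ (where $1/\Gamma=0$ at the poles of $\Gamma$) converges absolutely, and $$r(t)=\frac1t\,W_{-\alpha,0}\left(-L^{\alpha}t^{-\alpha}\right),\qquad W_{\lambda,\mu}(z)=\sum_{n=0}^{\infty}\frac{z^{n}}{n!\,\Gamma(\lambda n+\mu)}\quad(\lambda>-1,\ \mu\in\mathbb{C}),$$ $W_{\lambda,\mu}$ being the Wright function; the function $r$ is continuous on $(0,\infty)$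 and is the impulse response of $G$, unique up to null sets: a function $f:(0,\infty)\to\mathbb{C}$ is an impulse response of $G$ if and only if $f(t)=r(t)$ for almost every $t>0$. -/

import Mathlib

open Set MeasureTheory

noncomputable section

/-- `f`, as a function of `t > 0`, is an impulse response of the transfer function `G` (an inverse
Laplace transform of `G` that is a genuine function): on some right half-plane `c < Re s` the
Laplace integral of `f` converges absolutely and equals `G s`. Only the values of `f` on `(0, ∞)`
matter. -/
def IsImpulseResponse (f : ℝ → ℂ) (G : ℂ → ℂ) : Prop :=
  ∃ c : ℝ, ∀ s : ℂ, c < s.re →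
    IntegrableOn (fun t : ℝ => Complex.exp (-(s * (t : ℂ))) * f t) (Ioi 0) ∧
      ∫ t in Ioi (0 : ℝ), Complex.exp (-(s * (t : ℂ))) * f t = G s

/-- The fractional diffusive delay `exp (-(L s) ^ α)`, with the principal branch of the power. -/
def fractionalDiffusiveDelay (L α : ℝ) (s : ℂ) : ℂ :=
  Complex.exp (-(((L : ℂ) * s) ^ (α : ℂ)))

/-- The `i`-th term `(-L ^ α) ^ i / i! * t ^ (-α i - 1) / Γ (-α i)` of the series.
At the poles of `Γ` the reciprocal `1 / Γ` is `0`; this is what Lean computes, as Mathlib's `Γ` has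
the value `0` there and `x / 0 = 0`. -/
def fddTerm (L α t : ℝ) (i : ℕ) : ℝ :=
  (-(L ^ α)) ^ i / (Nat.factorial i : ℝ) * (t ^ (-α * (i : ℝ) - 1) / Real.Gamma (-α * (i : ℝ)))

/-- The Wright function `W_{lam, μ}(z) = ∑ z ^ n / (n! Γ (lam n + μ))`, for `lam > -1`, `μ ∈ ℂ`,
again with `1 / Γ = 0` at the poles of `Γ`. -/
def wrightFunction (lam : ℝ) (μ z : ℂ) : ℂ :=
  ∑' n : ℕ, z ^ n / ((Nat.factorial n : ℂ) * Complex.Gamma ((lam : ℂ) * (n : ℂ) + μ))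

end

/-!
Write `G s = exp (-(L s) ^ α)`.

For `0 < α < 1` put `θ = π / (1 + α)`, so that `π / 2 < θ < π` and `α θ < π / 2`. Along the rays
`z = x e ^ (± i θ)` both `e ^ (t z)` and `G z` decay, and the inverse Laplace transform of `G`,
bent onto these rays, is
`(1 / 2πi) (∫_{arg z = θ} - ∫_{arg z = -θ}) e ^ (t z) G z dz`.
* Expanding `G` into its exponential series and integrating term by term with the Gamma integral
  along a ray gives the terms `Γ(α k + 1) sin(π α k)`, up to elementary factors. The reflection formula
  turns them into `1 / Γ(-α k)`, so the integral is the sum `r` of the series in the statement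
  (`hasSum_rayIntegral`, `hasSum_fddTerm_complex`). Dominated convergence in the integral shows that
  `r` is continuous.
* By Fubini the Laplace transform of `r` at `s` is the Cauchy integral of `G z / (s - z)` over the
  boundary of the sector `|arg z| < θ`, hence equal to `G s` (`laplace_rayIntegral`,
  `integral_rayKernel_sub_integral_rayKernel_neg`). Cauchy's theorem is applied to rectangles in the
  plane of `log z` (`tendsto_strip_edge_sub_edge`).
* Uniqueness is the injectivity of the Fourier transform on `L¹`, applied on a vertical line
  (`IsImpulseResponse.ae_eq`).

For the other exponents `G` is not a Laplace transform. If `α ≤ 0` or `α = 1`, then `|G|` stays away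
from `0` on vertical lines, against the Riemann–Lebesgue lemma. If `α > 1`, then `|G|` is unbounded
along a ray in the right half-plane, whereas a Laplace transform is bounded on a right half-plane.
-/

section

open Filter Topology
open scoped FourierTransform SchwartzMap

noncomputable section

/-! ### Complex powers in polar coordinates and rotation of rays -/

lemma ofReal_mul_polar_cpow {L x φ : ℝ} (hL : 0 < L) (hx : 0 < x) (hφ : φ ∈ Ioc (-Real.pi) Real.pi)
    (a : ℝ) :
    ((L : ℂ) * ((x : ℂ) * Complex.exp (φ * Complex.I))) ^ (a : ℂ) =
      (((L * x) ^ a : ℝ) : ℂ) * Complex.exp (a * φ * Complex.I) := by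
  have h : (L : ℂ) * ((x : ℂ) * Complex.exp (φ * Complex.I))
      = Complex.exp (Real.log (L * x) + φ * Complex.I) := by
    rw [Complex.exp_add, ← Complex.ofReal_exp, Real.exp_log (by positivity)]; push_cast; ring
  have hlog : Complex.log (Complex.exp (Real.log (L * x) + φ * Complex.I))
      = Real.log (L * x) + φ * Complex.I :=
    Complex.log_exp (by simpa using hφ.1) (by simpa using hφ.2)
  rw [h, Complex.cpow_def_of_ne_zero (Complex.exp_ne_zero _), hlog,
    Real.rpow_def_of_pos (by positivity), Complex.ofReal_exp, ← Complex.exp_add]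
  congr 1; push_cast; ring

lemma integrable_exp_smul_comp_exp {f : ℝ → ℂ} (hf : IntegrableOn f (Ioi 0)) :
    Integrable (fun u : ℝ => Real.exp u • f (Real.exp u)) := by
  have h := (integrableOn_image_iff_integrableOn_abs_deriv_smul (s := univ) MeasurableSet.univ
      (fun x _ ↦ (Real.hasDerivAt_exp x).hasDerivWithinAt)
      (fun x _ y _ hxy ↦ Real.exp_injective hxy) f).1 (by simpa using hf)
  simpa [abs_of_pos (Real.exp_pos _)] using h

/-- The substitution `x = e ^ u`, as a limit of integrals over symmetric intervals: this is the form in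
which the horizontal edges of a rectangle in the logarithmic plane appear. -/
lemma tendsto_intervalIntegral_exp_smul_comp_exp {f : ℝ → ℂ} (hf : IntegrableOn f (Ioi 0)) :
    Tendsto (fun R : ℝ => ∫ u in (-R)..R, Real.exp u • f (Real.exp u)) atTop
      (𝓝 (∫ x in Ioi (0 : ℝ), f x)) := by
  have h := integral_image_eq_integral_abs_deriv_smul (s := univ) MeasurableSet.univ
      (fun x _ ↦ (Real.hasDerivAt_exp x).hasDerivWithinAt)
      (fun x _ y _ hxy ↦ Real.exp_injective hxy) f
  simp only [image_univ, Real.range_exp, abs_of_pos (Real.exp_pos _), Measure.restrict_univ] at h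
  rw [h]
  exact intervalIntegral_tendsto_integral (integrable_exp_smul_comp_exp hf)
    tendsto_neg_atTop_atBot tendsto_id

/-- Cauchy's theorem in a horizontal strip: if `H` is holomorphic on the closed strip between the heights
`c` and `d` and is at most `B R → 0` on the vertical segments over `±R`, then the integrals of `H`
along the two edges agree in the limit. In the variable `z = e ^ w` it compares two rays from `0`. -/
lemma tendsto_strip_edge_sub_edge {H : ℂ → ℂ} {c d : ℝ} {B : ℝ → ℝ}
    (hH : ∀ w : ℂ, w.im ∈ uIcc c d → DifferentiableAt ℂ H w)
    (hB : Tendsto B atTop (𝓝 0))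
    (hR : ∀ᶠ R : ℝ in atTop, ∀ y ∈ uIcc c d, ‖H (R + y * Complex.I)‖ ≤ B R)
    (hL : ∀ᶠ R : ℝ in atTop, ∀ y ∈ uIcc c d, ‖H ((-R : ℝ) + y * Complex.I)‖ ≤ B R) :
    Tendsto (fun R : ℝ => (∫ x in (-R)..R, H (x + c * Complex.I)) -
      ∫ x in (-R)..R, H (x + d * Complex.I)) atTop (𝓝 0) := by
  have hlim : Tendsto (fun R => B R * |d - c| + B R * |d - c|) atTop (𝓝 0) := by
    simpa using (hB.mul_const |d - c|).add (hB.mul_const |d - c|)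
  refine squeeze_zero_norm' ?_ hlim
  filter_upwards [hR, hL] with R h1 h2
  have key := Complex.integral_boundary_rect_eq_zero_of_differentiableOn H
    (((-R : ℝ) : ℂ) + c * Complex.I) ((R : ℂ) + d * Complex.I)
    (fun w hw => (hH w (by simpa using hw.2)).differentiableWithinAt)
  simp only [Complex.add_re, Complex.ofReal_re, Complex.mul_re, Complex.I_re, mul_zero,
    Complex.ofReal_im, Complex.I_im, mul_one, sub_self, add_zero, Complex.add_im, Complex.mul_im,
    zero_add] at key
  have e : (∫ x in (-R)..R, H (x + c * Complex.I)) - ∫ x in (-R)..R, H (x + d * Complex.I)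
      = Complex.I • (∫ y in c..d, H ((-R : ℝ) + y * Complex.I)) -
        Complex.I • ∫ y in c..d, H (R + y * Complex.I) := by
    linear_combination key
  rw [e]
  refine (norm_sub_le _ _).trans (add_le_add ?_ ?_)
  · rw [norm_smul, Complex.norm_I, one_mul]
    exact intervalIntegral.norm_integral_le_of_norm_le_const
      (fun y hy => h2 y (uIoc_subset_uIcc hy))
  · rw [norm_smul, Complex.norm_I, one_mul]
    exact intervalIntegral.norm_integral_le_of_norm_le_const
      (fun y hy => h1 y (uIoc_subset_uIcc hy))

lemma integrableOn_rpow_mul_cexp_neg_mul {a : ℝ} (ha : 0 < a) {z : ℂ} (hz : 0 < z.re) :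
    IntegrableOn (fun x : ℝ => ((x ^ (a - 1) : ℝ) : ℂ) * Complex.exp (-(z * x))) (Ioi 0) := by
  have h := integrableOn_rpow_mul_exp_neg_mul_rpow (p := 1) (s := a - 1) (by linarith) one_pos hz
  refine h.mono' ?_ ?_
  · refine ContinuousOn.aestronglyMeasurable ?_ measurableSet_Ioi
    refine ContinuousOn.mul ?_ (by fun_prop)
    exact Complex.continuous_ofReal.comp_continuousOn
      (continuousOn_id.rpow_const fun x hx => Or.inl (ne_of_gt hx))
  · filter_upwards [self_mem_ae_restrict measurableSet_Ioi] with x hx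
    rw [norm_mul, Complex.norm_real, Complex.norm_exp, Real.norm_of_nonneg
      (Real.rpow_nonneg (le_of_lt hx) _)]
    simp

/-- The Gamma integral `∫ x ^ (a - 1) e ^ (-z x) dx = Γ(a) z ^ (-a)` for complex `z = t e ^ (i ψ)` with
positive real part. The case `ψ = 0` is known, and the ray of integration is turned by `ψ`. -/
lemma integral_rpow_mul_exp_neg_polar {a t ψ : ℝ} (ha : 0 < a) (ht : 0 < t)
    (hψ : |ψ| < Real.pi / 2) :
    ∫ x in Ioi (0 : ℝ), ((x ^ (a - 1) : ℝ) : ℂ) *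
        Complex.exp (-(t * Complex.exp (ψ * Complex.I) * x)) =
      ((Real.Gamma a * t ^ (-a) : ℝ) : ℂ) * Complex.exp (-(a * ψ * Complex.I)) := by
  set H : ℂ → ℂ := fun w => Complex.exp (a * w - t * Complex.exp w) with hHdef
  have hψ' := abs_lt.1 hψ
  have hcos : 0 < Real.cos ψ := Real.cos_pos_of_mem_Ioo ⟨by linarith, by linarith⟩
  -- `cos ψ` is the least value of the cosine on the angles swept
  have hcosle : ∀ y ∈ uIcc 0 ψ, Real.cos ψ ≤ Real.cos y := by
    intro y hy
    rw [← Real.cos_abs ψ, ← Real.cos_abs y]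
    refine Real.cos_le_cos_of_nonneg_of_le_pi (abs_nonneg _) (by linarith [Real.pi_pos]) ?_
    rcases le_total 0 ψ with h | h
    · rw [uIcc_of_le h] at hy; rw [abs_of_nonneg hy.1, abs_of_nonneg h]; exact hy.2
    · rw [uIcc_of_ge h] at hy; rw [abs_of_nonpos hy.2, abs_of_nonpos h]; linarith [hy.1]
  have hnorm : ∀ x y : ℝ, ‖H (x + y * Complex.I)‖ =
      Real.exp (a * x - t * (Real.exp x * Real.cos y)) := by
    intro x y
    simp [hHdef, Complex.norm_exp, Complex.exp_re]
  have hray : ∀ χ : ℝ, ∀ x : ℝ, H (x + χ * Complex.I) = Complex.exp (a * χ * Complex.I) *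
      (Real.exp x • (((Real.exp x ^ (a - 1) : ℝ) : ℂ) *
        Complex.exp (-(t * Complex.exp (χ * Complex.I) * Real.exp x)))) := by
    intro χ x
    rw [← Real.exp_mul, Complex.real_smul]
    simp only [hHdef, Complex.ofReal_exp]
    rw [← Complex.exp_add, ← Complex.exp_add, ← Complex.exp_add]
    congr 1
    rw [Complex.exp_add]; push_cast; ring
  have hlimray : ∀ χ : ℝ, 0 < Real.cos χ →
      Tendsto (fun R : ℝ => ∫ x in (-R)..R, H (x + χ * Complex.I)) atTop
        (𝓝 (Complex.exp (a * χ * Complex.I) * ∫ x in Ioi (0 : ℝ), ((x ^ (a - 1) : ℝ) : ℂ) *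
        Complex.exp (-(t * Complex.exp (χ * Complex.I) * x)))) := by
    intro χ hχ
    simp_rw [hray χ, intervalIntegral.integral_const_mul]
    refine Tendsto.const_mul _ (tendsto_intervalIntegral_exp_smul_comp_exp
      (f := fun x => ((x ^ (a - 1) : ℝ) : ℂ) *
        Complex.exp (-(t * Complex.exp (χ * Complex.I) * x))) ?_)
    refine integrableOn_rpow_mul_cexp_neg_mul ha ?_
    rw [Complex.re_ofReal_mul, Complex.exp_ofReal_mul_I_re]; positivity
  have hstrip := tendsto_strip_edge_sub_edge (H := H) (c := 0) (d := ψ)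
    (B := fun R => Real.exp (a * R - t * Real.cos ψ * Real.exp R) + Real.exp (-(a * R)))
    (fun w _ => by fun_prop) ?_ ?_ ?_
  · have h := tendsto_nhds_unique hstrip ((hlimray 0 (by simp)).sub (hlimray ψ hcos))
    have h0 : ∫ x in Ioi (0 : ℝ), ((x ^ (a - 1) : ℝ) : ℂ) *
        Complex.exp (-(t * Complex.exp ((0 : ℝ) * Complex.I) * x)) =
        ((Real.Gamma a * t ^ (-a) : ℝ) : ℂ) := by
      have := Real.integral_rpow_mul_exp_neg_mul_Ioi ha ht
      rw [one_div, Real.inv_rpow ht.le, ← Real.rpow_neg ht.le, mul_comm] at this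
      rw [← this, ← integral_complex_ofReal]
      congr 1; ext x; push_cast; simp
    rw [h0] at h
    have h2 : Complex.exp (a * ψ * Complex.I) * Complex.exp (-(a * ψ * Complex.I)) = 1 := by
      rw [← Complex.exp_add]; simp
    simp only [Complex.ofReal_zero, mul_zero, zero_mul, Complex.exp_zero, one_mul] at h
    rw [sub_eq_zero.1 h.symm, mul_right_comm, h2, one_mul]
  -- the two exponentials in the bound are the sizes of `H` far to the right and far to the left
  · have h1 : Tendsto (fun R : ℝ => a * R - t * Real.cos ψ * Real.exp R) atTop atBot := by
      have h3 : Tendsto (fun R : ℝ => t * Real.cos ψ * (Real.exp R / R) - a) atTop atTop :=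
        tendsto_atTop_add_const_right _ _ (Tendsto.const_mul_atTop (by positivity)
          (by simpa using Real.tendsto_exp_div_pow_atTop 1))
      have h4 := tendsto_neg_atTop_atBot.comp (h3.atTop_mul_atTop₀ tendsto_id)
      refine h4.congr' ?_
      filter_upwards [eventually_gt_atTop 0] with R hR
      simp only [Function.comp, id]; field_simp; ring
    have h5 : Tendsto (fun R : ℝ => -(a * R)) atTop atBot :=
      tendsto_neg_atTop_atBot.comp (tendsto_id.const_mul_atTop ha)
    simpa using (Real.tendsto_exp_atBot.comp h1).add (Real.tendsto_exp_atBot.comp h5)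
  · refine Eventually.of_forall fun R y hy => ?_
    rw [hnorm]
    refine le_add_of_le_of_nonneg (Real.exp_le_exp.2 ?_) (Real.exp_pos _).le
    have := mul_le_mul_of_nonneg_left (hcosle y hy) (mul_pos ht (Real.exp_pos R)).le
    nlinarith
  · refine Eventually.of_forall fun R y hy => ?_
    rw [hnorm]
    refine le_add_of_nonneg_of_le (Real.exp_pos _).le (Real.exp_le_exp.2 ?_)
    have := mul_pos (mul_pos ht (Real.exp_pos (-R))) (hcos.trans_le (hcosle y hy))
    nlinarith

/-! ### Integrals along rays and the series of the impulse response -/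

/-- The value `exp (-(L z) ^ α)` at the point `z = x e ^ (i φ)` of a ray, in polar form. -/
def rayKernel (L α φ x : ℝ) : ℂ :=
  Complex.exp (-((((L * x) ^ α : ℝ) : ℂ) * Complex.exp (α * φ * Complex.I)))

/-- The integral of `e ^ (t z) exp (-(L z) ^ α)` along the ray from `0` to `∞` at angle `φ`. -/
def rayIntegral (L α φ t : ℝ) : ℂ :=
  ∫ x in Ioi (0 : ℝ), Complex.exp (t * x * Complex.exp (φ * Complex.I)) * rayKernel L α φ x *
    Complex.exp (φ * Complex.I)

lemma norm_rayKernel (L α φ x : ℝ) :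
    ‖rayKernel L α φ x‖ = Real.exp (-(Real.cos (α * φ) * (L * x) ^ α)) := by
  rw [rayKernel, Complex.norm_exp, Complex.neg_re, Complex.re_ofReal_mul, ← Complex.ofReal_mul,
    Complex.exp_ofReal_mul_I_re, mul_comm]

lemma continuous_rayKernel {α : ℝ} (hα : 0 < α) (L φ : ℝ) : Continuous (rayKernel L α φ) := by
  have : Continuous fun x : ℝ => (L * x) ^ α :=
    (continuous_const.mul continuous_id).rpow_const fun _ => Or.inr hα.le
  unfold rayKernel
  fun_prop

lemma integrableOn_rayKernel {L α φ : ℝ} (hL : 0 < L) (hα : 0 < α) (hc : 0 < Real.cos (α * φ)) :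
    IntegrableOn (rayKernel L α φ) (Ioi 0) := by
  have h := integrableOn_rpow_mul_exp_neg_mul_rpow (p := α) (s := 0)
    (b := Real.cos (α * φ) * L ^ α) (by norm_num) hα (by positivity)
  refine h.mono' (continuous_rayKernel hα L φ).aestronglyMeasurable ?_
  filter_upwards [self_mem_ae_restrict measurableSet_Ioi] with x hx
  rw [norm_rayKernel, Real.mul_rpow hL.le (le_of_lt hx)]
  simp [mul_assoc]

lemma norm_exp_ray (t x φ : ℝ) :
    ‖Complex.exp (t * x * Complex.exp (φ * Complex.I))‖ = Real.exp (t * x * Real.cos φ) := by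
  rw [Complex.norm_exp, ← Complex.ofReal_mul, Complex.re_ofReal_mul, Complex.exp_ofReal_mul_I_re]

lemma integrableOn_exp_mul_exp_rpow {L α b : ℝ} (hL : 0 < L) (hα : 0 < α) (hα1 : α < 1)
    (hb : 0 < b) :
    IntegrableOn (fun x : ℝ => Real.exp (-(b * x)) * Real.exp ((L * x) ^ α)) (Ioi 0) := by
  refine integrable_of_isBigO_exp_neg (b := b / 2) (by positivity) ?_ ?_
  · have : Continuous fun x : ℝ => (L * x) ^ α :=
      (continuous_const.mul continuous_id).rpow_const fun _ => Or.inr hα.le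
    fun_prop
  · refine Asymptotics.IsBigO.of_bound 1 ?_
    have h1 : Tendsto (fun x : ℝ => L ^ α * x ^ (-(1 - α))) atTop (𝓝 0) := by
      simpa using (tendsto_rpow_neg_atTop (sub_pos.2 hα1)).const_mul (L ^ α)
    filter_upwards [h1.eventually (gt_mem_nhds (half_pos hb)), eventually_gt_atTop 0] with x hx hx0
    rw [← Real.exp_add, Real.norm_of_nonneg (Real.exp_pos _).le,
      Real.norm_of_nonneg (Real.exp_pos _).le, one_mul]
    refine Real.exp_le_exp.2 ?_
    have h2 : (L * x) ^ α = L ^ α * x ^ (-(1 - α)) * x := by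
      rw [Real.mul_rpow hL.le hx0.le, mul_assoc, ← Real.rpow_add_one hx0.ne']
      congr 2; ring
    rw [h2]
    nlinarith

/-- Term by term integration of the exponential series of `exp (-(L z) ^ α)` along a ray in the left
half-plane. Here `σ = ±π` is the multiple of `π` on the side of `φ`, so that
`-e ^ (i φ) = e ^ (i (φ - σ))` has positive real part. The angle `φ` drops out of the terms. -/
lemma hasSum_rayIntegral {L α φ σ t : ℝ} (hL : 0 < L) (hα : 0 < α) (hα1 : α < 1) (ht : 0 < t)
    (hσ : Complex.exp (σ * Complex.I) = -1) (hφ : |φ - σ| < Real.pi / 2) :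
    HasSum (fun k : ℕ => (((-(L ^ α)) ^ k / (k.factorial : ℝ) *
        (Real.Gamma (α * k + 1) * t ^ (-(α * k + 1))) : ℝ) : ℂ) *
        Complex.exp ((α * k + 1 : ℝ) * σ * Complex.I)) (rayIntegral L α φ t) := by
  set ζ := Complex.exp (φ * Complex.I) with hζ
  have hζσ : -ζ = Complex.exp ((φ - σ : ℝ) * Complex.I) := by
    have h : ζ = Complex.exp ((φ - σ : ℝ) * Complex.I) * Complex.exp (σ * Complex.I) := by
      rw [hζ, ← Complex.exp_add]; congr 1; push_cast; ring
    rw [h, hσ]; ring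
  have hcos : Real.cos φ < 0 := by
    have h1 := congrArg Complex.re hζσ
    rw [Complex.neg_re, hζ, Complex.exp_ofReal_mul_I_re, Complex.exp_ofReal_mul_I_re] at h1
    have := Real.cos_pos_of_mem_Ioo (x := φ - σ) ⟨by linarith [(abs_lt.1 hφ).1], (abs_lt.1 hφ).2⟩
    linarith
  set F : ℕ → ℝ → ℂ := fun k x => Complex.exp (t * x * ζ) *
    ((-((((L * x) ^ α : ℝ) : ℂ) * Complex.exp (α * φ * Complex.I))) ^ k / (k.factorial : ℂ)) * ζ
  have hrp : Continuous fun x : ℝ => (L * x) ^ α :=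
    (continuous_const.mul continuous_id).rpow_const fun _ => Or.inr hα.le
  have hsum := hasSum_integral_of_dominated_convergence (μ := volume.restrict (Ioi (0 : ℝ)))
    (F := F) (f := fun x => Complex.exp (t * x * ζ) * rayKernel L α φ x * ζ)
    (fun k x => Real.exp (t * x * Real.cos φ) * (((L * x) ^ α) ^ k / (k.factorial : ℝ)))
    ?_ ?_ ?_ ?_ ?_
  · convert! hsum using 2 with k
    have hk : ∀ x ∈ Ioi (0 : ℝ), F k x =
        ((((-(L ^ α)) ^ k / (k.factorial : ℝ) : ℝ) : ℂ) *
          Complex.exp ((α * k + 1 : ℝ) * φ * Complex.I)) *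
        (((x ^ ((α * k + 1) - 1) : ℝ) : ℂ) *
          Complex.exp (-(t * Complex.exp ((φ - σ : ℝ) * Complex.I) * x))) := by
      intro x hx
      have e1 : Complex.exp ((α * k + 1 : ℝ) * φ * Complex.I) =
          Complex.exp (α * φ * Complex.I) ^ k * ζ := by
        rw [← Complex.exp_nat_mul, hζ, ← Complex.exp_add]; congr 1; push_cast; ring
      have e2 : x ^ ((α * k + 1) - 1) = (x ^ α) ^ k := by
        rw [add_sub_cancel_right, Real.rpow_mul (le_of_lt hx), Real.rpow_natCast]
      rw [← hζσ, e1, e2]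
      simp only [F]
      rw [Real.mul_rpow hL.le (le_of_lt hx)]
      have e3 : -(t * -ζ * x) = t * x * ζ := by ring
      rw [e3, neg_pow, mul_pow]
      push_cast
      rw [neg_pow ((L ^ α : ℝ) : ℂ), mul_pow]
      ring
    rw [setIntegral_congr_fun measurableSet_Ioi hk, integral_const_mul,
      integral_rpow_mul_exp_neg_polar (by positivity) ht hφ]
    have e4 : Complex.exp ((α * k + 1 : ℝ) * σ * Complex.I) =
        Complex.exp ((α * k + 1 : ℝ) * φ * Complex.I) *
        Complex.exp (-((α * k + 1 : ℝ) * (φ - σ : ℝ) * Complex.I)) := by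
      rw [← Complex.exp_add]; congr 1; push_cast; ring
    rw [e4]; push_cast; ring
  · intro k
    refine Continuous.aestronglyMeasurable ?_
    simp only [F]
    fun_prop
  · intro k
    filter_upwards [self_mem_ae_restrict measurableSet_Ioi] with x hx
    have hx' : 0 < L * x := mul_pos hL hx
    simp only [F]
    rw [norm_mul, norm_mul, norm_exp_ray, norm_div, norm_pow, norm_neg, norm_mul, hζ,
      Complex.norm_exp_ofReal_mul_I, ← Complex.ofReal_mul, Complex.norm_exp_ofReal_mul_I,
      Complex.norm_real, Real.norm_of_nonneg (by positivity)]
    simp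
  · exact Eventually.of_forall fun x => (Real.summable_pow_div_factorial _).mul_left _
  · have h := integrableOn_exp_mul_exp_rpow hL hα hα1 (b := t * -Real.cos φ)
      (mul_pos ht (neg_pos.2 hcos))
    refine h.congr_fun ?_ measurableSet_Ioi
    intro x _
    simp only
    rw [tsum_mul_left, Real.exp_eq_exp_ℝ, NormedSpace.exp_eq_tsum_div]
    ring_nf
  · refine Eventually.of_forall fun x => ?_
    refine HasSum.mul_right _ (HasSum.mul_left _ ?_)
    rw [rayKernel, Complex.exp_eq_exp_ℂ]
    exact NormedSpace.expSeries_div_hasSum_exp _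

/-- The reflection formula for `1 / Γ` at `-x ≤ 0`, valid also at the poles of `Γ`, where both sides are
`0` under the conventions `Γ = 0` and `1 / 0 = 0`. -/
lemma inv_Gamma_neg {x : ℝ} (hx : 0 ≤ x) :
    1 / Real.Gamma (-x) = -(Real.sin (Real.pi * x) * Real.Gamma (x + 1) / Real.pi) := by
  have h := Real.Gamma_mul_Gamma_one_sub (-x)
  have hG : Real.Gamma (x + 1) ≠ 0 := (Real.Gamma_pos_of_pos (by linarith)).ne'
  have e : 1 - -x = x + 1 := by ring
  rw [e, ← eq_div_iff hG] at h
  rw [h, mul_neg, Real.sin_neg]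
  rcases eq_or_ne (Real.sin (Real.pi * x)) 0 with h0 | h0
  · simp [h0]
  · field_simp

/-- The angle `θ` of the rays. It lies in `(π / 2, π)`, so that `e ^ (t z)` decays along the ray, and
`α θ = π - θ` lies in `(0, π / 2)`, so that `exp (-(L z) ^ α)` decays too. -/
def rayAngle (α : ℝ) : ℝ := Real.pi / (1 + α)

lemma rayAngle_bounds {α : ℝ} (hα : 0 < α) (hα1 : α < 1) :
    Real.pi / 2 < rayAngle α ∧ rayAngle α < Real.pi ∧ α * rayAngle α = Real.pi - rayAngle α := by
  unfold rayAngle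
  have := Real.pi_pos
  refine ⟨?_, ?_, ?_⟩
  · exact div_lt_div_of_pos_left this (by linarith) (by linarith)
  · exact div_lt_self this (by linarith)
  · field_simp; ring

/-- The impulse response `r` of the fractional diffusive delay, defined as the sum of its series. -/
def fddResponse (L α t : ℝ) : ℝ := ∑' i : ℕ, fddTerm L α t i

/-- The series for the two rays at angles `±rayAngle α` combine, by the reflection formula, to the series
of the impulse response. -/
lemma hasSum_fddTerm_complex {L α t : ℝ} (hL : 0 < L) (hα : 0 < α) (hα1 : α < 1) (ht : 0 < t) :
    HasSum (fun i : ℕ => (fddTerm L α t i : ℂ))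
      ((rayIntegral L α (rayAngle α) t - rayIntegral L α (-rayAngle α) t) /
        (2 * Real.pi * Complex.I)) := by
  obtain ⟨h1, h2, -⟩ := rayAngle_bounds hα hα1
  have hp := hasSum_rayIntegral (φ := rayAngle α) (σ := Real.pi) hL hα hα1 ht
    Complex.exp_pi_mul_I (by rw [abs_lt]; constructor <;> linarith)
  have hm := hasSum_rayIntegral (φ := -rayAngle α) (σ := -Real.pi) hL hα hα1 ht
    (by rw [Complex.ofReal_neg, neg_mul, Complex.exp_neg, Complex.exp_pi_mul_I]; norm_num)
    (by rw [abs_lt]; constructor <;> linarith)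
  convert! (hp.sub hm).div_const (2 * Real.pi * Complex.I) using 2 with i
  have hs : Complex.exp ((α * i + 1 : ℝ) * Real.pi * Complex.I) -
      Complex.exp ((α * i + 1 : ℝ) * (-Real.pi : ℝ) * Complex.I) =
      2 * Complex.I * ((-Real.sin (Real.pi * (α * i)) : ℝ) : ℂ) := by
    have e : -Real.sin (Real.pi * (α * i)) = Real.sin ((α * i + 1) * Real.pi) := by
      rw [add_mul, one_mul, Real.sin_add_pi, mul_comm]
    rw [e, Complex.ofReal_sin, Complex.sin]
    push_cast
    rw [mul_neg]
    linear_combination (-Complex.exp (-((α * i + 1) * Real.pi) * Complex.I)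
      + Complex.exp ((α * i + 1) * Real.pi * Complex.I)) * Complex.I_sq
  rw [← mul_sub, hs]
  have hg := inv_Gamma_neg (x := α * i) (by positivity)
  have hterm : fddTerm L α t i = (-(L ^ α)) ^ i / (i.factorial : ℝ) *
      (Real.Gamma (α * i + 1) * t ^ (-(α * i + 1))) * (-Real.sin (Real.pi * (α * i))) / Real.pi := by
    rw [fddTerm, neg_mul, div_eq_mul_one_div (t ^ _), hg,
      show -(α * (i : ℝ)) - 1 = -(α * i + 1) by ring]
    ring
  rw [hterm]
  push_cast
  have := Complex.ofReal_ne_zero.2 Real.pi_ne_zero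
  field_simp [Complex.I_ne_zero]

lemma ofReal_fddResponse {L α t : ℝ} (hL : 0 < L) (hα : 0 < α) (hα1 : α < 1) (ht : 0 < t) :
    (fddResponse L α t : ℂ) =
      (rayIntegral L α (rayAngle α) t - rayIntegral L α (-rayAngle α) t) /
        (2 * Real.pi * Complex.I) := by
  rw [fddResponse, Complex.ofReal_tsum]
  exact (hasSum_fddTerm_complex hL hα hα1 ht).tsum_eq

lemma hasSum_fddTerm {L α t : ℝ} (hL : 0 < L) (hα : 0 < α) (hα1 : α < 1) (ht : 0 < t) :
    HasSum (fddTerm L α t) (fddResponse L α t) :=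
  (Complex.summable_ofReal.1 (hasSum_fddTerm_complex hL hα hα1 ht).summable).hasSum

lemma fddResponse_eq_wrightFunction {L α t : ℝ} (ht : 0 < t) :
    (fddResponse L α t : ℂ) =
      wrightFunction (-α) 0 ((-(L ^ α * t ^ (-α)) : ℝ) : ℂ) / (t : ℂ) := by
  rw [fddResponse, Complex.ofReal_tsum, wrightFunction, ← tsum_div_const]
  refine tsum_congr fun i => ?_
  have e : ((-α : ℝ) : ℂ) * (i : ℂ) + 0 = ((-α * i : ℝ) : ℂ) := by push_cast; ring
  rw [e, Complex.Gamma_ofReal, fddTerm, Real.rpow_sub_one ht.ne', Real.rpow_mul ht.le,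
    Real.rpow_natCast]
  push_cast
  rw [← neg_mul, mul_pow]
  ring

lemma continuousOn_rayIntegral {L α φ : ℝ} (hL : 0 < L) (hα : 0 < α)
    (hc : 0 < Real.cos (α * φ)) (hφ : Real.cos φ ≤ 0) :
    ContinuousOn (rayIntegral L α φ) (Ioi 0) := by
  refine continuousOn_of_dominated (bound := fun x => ‖rayKernel L α φ x‖) ?_ ?_
    (integrableOn_rayKernel hL hα hc).norm ?_
  · intro t _
    have := continuous_rayKernel hα L φ
    exact Continuous.aestronglyMeasurable (by fun_prop)
  · intro t ht
    filter_upwards [self_mem_ae_restrict measurableSet_Ioi] with x hx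
    rw [norm_mul, norm_mul, norm_exp_ray, Complex.norm_exp_ofReal_mul_I, mul_one]
    refine mul_le_of_le_one_left (norm_nonneg _) (Real.exp_le_one_iff.2 ?_)
    exact mul_nonpos_of_nonneg_of_nonpos (mul_pos ht hx).le hφ
  · exact Eventually.of_forall fun x => by fun_prop

lemma cos_rayAngle {α : ℝ} (hα : 0 < α) (hα1 : α < 1) :
    Real.cos (rayAngle α) < 0 ∧ 0 < Real.cos (α * rayAngle α) := by
  obtain ⟨h1, h2, h3⟩ := rayAngle_bounds hα hα1
  have h := Real.cos_neg_of_pi_div_two_lt_of_lt h1 (by linarith [Real.pi_pos])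
  exact ⟨h, by rw [h3, Real.cos_pi_sub]; linarith⟩

lemma continuousOn_fddResponse {L α : ℝ} (hL : 0 < L) (hα : 0 < α) (hα1 : α < 1) :
    ContinuousOn (fddResponse L α) (Ioi 0) := by
  obtain ⟨h1, h2⟩ := cos_rayAngle hα hα1
  have hc := ((continuousOn_rayIntegral (φ := rayAngle α) hL hα h2 h1.le).sub
    (continuousOn_rayIntegral (φ := -rayAngle α) hL hα (by rwa [mul_neg, Real.cos_neg])
      (by rw [Real.cos_neg]; exact h1.le))).div_const (2 * Real.pi * Complex.I)
  refine (Complex.continuous_re.comp_continuousOn hc).congr fun t ht => ?_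
  rw [Function.comp_apply]
  exact congrArg Complex.re (ofReal_fddResponse hL hα hα1 ht)

/-! ### Laplace transforms of the ray integrals and Cauchy's formula in a sector -/

lemma re_le_re_sub_ray {s : ℂ} {φ x : ℝ} (hx : 0 ≤ x) (hφ : Real.cos φ ≤ 0) :
    s.re ≤ (s - x * Complex.exp (φ * Complex.I)).re := by
  rw [Complex.sub_re, Complex.re_ofReal_mul, Complex.exp_ofReal_mul_I_re]
  nlinarith [mul_nonneg hx (neg_nonneg.2 hφ)]

/-- By Fubini, the Laplace transform of a ray integral is a Cauchy integral along that ray. -/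
lemma laplace_rayIntegral {L α φ : ℝ} (hL : 0 < L) (hα : 0 < α)
    (hc : 0 < Real.cos (α * φ)) (hφ : Real.cos φ ≤ 0) {s : ℂ} (hs : 0 < s.re) :
    IntegrableOn (fun t : ℝ => Complex.exp (-(s * t)) * rayIntegral L α φ t) (Ioi 0) ∧
      ∫ t in Ioi (0 : ℝ), Complex.exp (-(s * t)) * rayIntegral L α φ t =
        ∫ x in Ioi (0 : ℝ), rayKernel L α φ x * Complex.exp (φ * Complex.I) /
          (s - x * Complex.exp (φ * Complex.I)) := by
  have hk := continuous_rayKernel hα L φ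
  set ζ := Complex.exp (φ * Complex.I) with hζ
  set f : ℝ → ℝ → ℂ := fun t x =>
    Complex.exp (-(s * t)) * (Complex.exp (t * x * ζ) * rayKernel L α φ x * ζ) with hf
  have hint : Integrable (Function.uncurry f)
      ((volume.restrict (Ioi (0 : ℝ))).prod (volume.restrict (Ioi (0 : ℝ)))) := by
    have hexp : IntegrableOn (fun t : ℝ => Real.exp (-s.re * t)) (Ioi 0) :=
      integrableOn_exp_mul_Ioi (by linarith) 0
    have hprod := hexp.mul_prod (integrableOn_rayKernel hL hα hc).norm
    refine hprod.mono' (Continuous.aestronglyMeasurable ?_) ?_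
    · simp only [hf, Function.uncurry_def]; fun_prop
    · rw [Measure.prod_restrict]
      filter_upwards [self_mem_ae_restrict (measurableSet_Ioi.prod measurableSet_Ioi)] with p hp
      have hp1 : 0 < p.1 := hp.1
      have hp2 : 0 < p.2 := hp.2
      simp only [hf, Function.uncurry_def]
      rw [norm_mul, norm_mul, norm_mul, hζ, norm_exp_ray, Complex.norm_exp_ofReal_mul_I, mul_one,
        Complex.norm_exp, Complex.neg_re, Complex.re_mul_ofReal, neg_mul]
      refine mul_le_mul_of_nonneg_left ?_ (Real.exp_pos _).le
      refine mul_le_of_le_one_left (norm_nonneg _) (Real.exp_le_one_iff.2 ?_)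
      exact mul_nonpos_of_nonneg_of_nonpos (mul_pos hp1 hp2).le hφ
  have hinner : ∀ t : ℝ, ∫ x in Ioi (0 : ℝ), f t x =
      Complex.exp (-(s * t)) * rayIntegral L α φ t := fun t => integral_const_mul _ _
  refine ⟨?_, ?_⟩
  · have := hint.integral_prod_left
    simp only [Function.uncurry_apply_pair, hinner] at this
    exact this
  · simp_rw [← hinner]
    rw [integral_integral_swap hint]
    refine setIntegral_congr_fun measurableSet_Ioi fun x hx => ?_
    have hre : 0 < (s - x * ζ).re := hs.trans_le (re_le_re_sub_ray (le_of_lt hx) hφ)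
    have e : ∀ t : ℝ, f t x = Complex.exp (-(s - x * ζ) * t) * (rayKernel L α φ x * ζ) := by
      intro t
      simp only [hf]
      rw [mul_assoc, ← mul_assoc, ← Complex.exp_add]
      congr 2; ring
    simp_rw [e]
    rw [integral_mul_const, integral_exp_mul_complex_Ioi (by rw [Complex.neg_re]; linarith)]
    simp only [Complex.ofReal_zero, mul_zero, Complex.exp_zero, neg_div_neg_eq]
    ring

lemma fractionalDiffusiveDelay_polar {L x φ : ℝ} (hL : 0 < L) (hx : 0 < x)
    (hφ : φ ∈ Ioc (-Real.pi) Real.pi) (α : ℝ) :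
    fractionalDiffusiveDelay L α (x * Complex.exp (φ * Complex.I)) = rayKernel L α φ x := by
  rw [fractionalDiffusiveDelay, ofReal_mul_polar_cpow hL hx hφ, rayKernel]

/-- The integral of `(1 + s) / ((1 + z) (s - z))` along a ray, by means of the antiderivative
`log (1 + z) - log (s - z)`. The values for the two rays at angles `±θ` differ by `2 π i`, the
contribution of the pole at `s`. -/
lemma tendsto_integral_rational_ray {s : ℂ} (hs : 0 < s.re) {φ σ : ℝ}
    (hφ : φ ∈ Ioc (-Real.pi) Real.pi) (hsin : Real.sin φ ≠ 0)
    (hσ : Complex.exp (σ * Complex.I) = -1) (hφσ : |φ - σ| < Real.pi / 2) :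
    Tendsto (fun R : ℝ => ∫ u in (-R)..R, (1 + s) * (Real.exp u * Complex.exp (φ * Complex.I)) /
        ((1 + Real.exp u * Complex.exp (φ * Complex.I)) *
          (s - Real.exp u * Complex.exp (φ * Complex.I)))) atTop
      (𝓝 (σ * Complex.I + Complex.log s)) := by
  set ζ := Complex.exp (φ * Complex.I) with hζ
  have hζσ : -ζ = Complex.exp ((φ - σ : ℝ) * Complex.I) := by
    have h : ζ = Complex.exp ((φ - σ : ℝ) * Complex.I) * Complex.exp (σ * Complex.I) := by
      rw [hζ, ← Complex.exp_add]; congr 1; push_cast; ring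
    rw [h, hσ]; ring
  have hab := abs_lt.1 hφσ
  have hζre : 0 < (-ζ).re := by
    rw [hζσ, Complex.exp_ofReal_mul_I_re]
    exact Real.cos_pos_of_mem_Ioo ⟨by linarith, by linarith⟩
  have hζim : ζ.im ≠ 0 := by rwa [hζ, Complex.exp_ofReal_mul_I_im]
  have hlogζ : Complex.log ζ = φ * Complex.I :=
    Complex.log_exp (by simpa using hφ.1) (by simpa using hφ.2)
  have hlognegζ : Complex.log (-ζ) = (φ - σ : ℝ) * Complex.I := by
    rw [hζσ]
    refine Complex.log_exp ?_ ?_ <;> simp <;> linarith [Real.pi_pos]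
  have hsp1 : ∀ u : ℝ, 1 + (Real.exp u : ℂ) * ζ ∈ Complex.slitPlane := by
    intro u
    refine Or.inr ?_
    rw [Complex.add_im, Complex.one_im, Complex.im_ofReal_mul, zero_add]
    exact mul_ne_zero (Real.exp_pos u).ne' hζim
  have hsp2 : ∀ u : ℝ, s - (Real.exp u : ℂ) * ζ ∈ Complex.slitPlane := by
    intro u
    refine Or.inl ?_
    rw [sub_eq_add_neg, ← mul_neg, Complex.add_re, Complex.re_ofReal_mul]
    have := Real.exp_pos u
    positivity
  set F : ℝ → ℂ := fun u => Complex.log (1 + Real.exp u * ζ) - Complex.log (s - Real.exp u * ζ)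
    with hF
  have hderiv : ∀ u : ℝ, HasDerivAt F
      ((1 + s) * (Real.exp u * ζ) / ((1 + Real.exp u * ζ) * (s - Real.exp u * ζ))) u := by
    intro u
    have h0 : HasDerivAt (fun u : ℝ => (Real.exp u : ℂ) * ζ) (Real.exp u * ζ) u :=
      (Real.hasDerivAt_exp u).ofReal_comp.mul_const ζ
    have h1 := (h0.const_add 1).clog_real (hsp1 u)
    have h2 := (h0.const_sub s).clog_real (hsp2 u)
    convert! h1.sub h2 using 1
    have n1 := Complex.slitPlane_ne_zero (hsp1 u)
    have n2 := Complex.slitPlane_ne_zero (hsp2 u)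
    field_simp
    ring
  have hcont : Continuous fun u : ℝ =>
      (1 + s) * (Real.exp u * ζ) / ((1 + Real.exp u * ζ) * (s - Real.exp u * ζ)) := by
    refine Continuous.div (by fun_prop) (by fun_prop) fun u => ?_
    exact mul_ne_zero (Complex.slitPlane_ne_zero (hsp1 u)) (Complex.slitPlane_ne_zero (hsp2 u))
  have hint : ∀ R : ℝ, ∫ u in (-R)..R,
      (1 + s) * (Real.exp u * ζ) / ((1 + Real.exp u * ζ) * (s - Real.exp u * ζ)) =
      F R - F (-R) := fun R =>
    intervalIntegral.integral_eq_sub_of_hasDerivAt (fun u _ => hderiv u)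
      (hcont.intervalIntegrable _ _)
  simp_rw [hint]
  have he : Tendsto (fun R : ℝ => (Real.exp (-R) : ℂ)) atTop (𝓝 0) := by
    have := (Complex.continuous_ofReal.tendsto 0).comp
      (Real.tendsto_exp_atBot.comp tendsto_neg_atTop_atBot)
    simpa [Function.comp_def] using this
  have htop : Tendsto F atTop (𝓝 (σ * Complex.I)) := by
    -- the factor `e ^ R` is taken out of both logarithms and cancels
    have e : ∀ R : ℝ, F R = Complex.log ((Real.exp (-R) : ℂ) + ζ) -
        Complex.log ((Real.exp (-R) : ℂ) * s + -ζ) := by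
      intro R
      have hER : (Real.exp R : ℂ) * (Real.exp (-R) : ℂ) = 1 := by
        rw [← Complex.ofReal_mul, ← Real.exp_add]; simp
      have e1 : 1 + (Real.exp R : ℂ) * ζ = (Real.exp R : ℂ) * ((Real.exp (-R) : ℂ) + ζ) := by
        linear_combination -hER
      have e2 : s - (Real.exp R : ℂ) * ζ =
          (Real.exp R : ℂ) * ((Real.exp (-R) : ℂ) * s + -ζ) := by
        linear_combination -s * hER
      have n1 := Complex.slitPlane_ne_zero (hsp1 R)
      have n2 := Complex.slitPlane_ne_zero (hsp2 R)
      simp only [hF]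
      rw [e1] at n1
      rw [e2] at n2
      rw [e1, e2, Complex.log_ofReal_mul (Real.exp_pos R) (right_ne_zero_of_mul n1),
        Complex.log_ofReal_mul (Real.exp_pos R) (right_ne_zero_of_mul n2)]
      ring
    have l1 : Tendsto (fun R : ℝ => (Real.exp (-R) : ℂ) + ζ) atTop (𝓝 ζ) := by
      simpa using he.add_const ζ
    have l2 : Tendsto (fun R : ℝ => (Real.exp (-R) : ℂ) * s + -ζ) atTop (𝓝 (-ζ)) := by
      simpa using (he.mul_const s).add_const (-ζ)
    have := (l1.clog (Or.inr hζim)).sub (l2.clog (Or.inl hζre))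
    rw [hlogζ, hlognegζ] at this
    refine (this.congr fun R => (e R).symm).trans_eq ?_
    congr 1; push_cast; ring
  have hbot : Tendsto (fun R => F (-R)) atTop (𝓝 (-Complex.log s)) := by
    have l1 : Tendsto (fun R : ℝ => 1 + (Real.exp (-R) : ℂ) * ζ) atTop (𝓝 1) := by
      simpa using (he.mul_const ζ).const_add 1
    have l2 : Tendsto (fun R : ℝ => s - (Real.exp (-R) : ℂ) * ζ) atTop (𝓝 s) := by
      simpa using (he.mul_const ζ).const_sub s
    have h := (l1.clog Complex.one_mem_slitPlane).sub (l2.clog (Or.inl hs))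
    rwa [Complex.log_one, zero_sub] at h
  simpa using htop.sub hbot

lemma integrableOn_rayKernel_div {L α φ : ℝ} (hL : 0 < L) (hα : 0 < α)
    (hc : 0 < Real.cos (α * φ)) (hφ : Real.cos φ ≤ 0) {s : ℂ} (hs : 0 < s.re) :
    IntegrableOn (fun x : ℝ => rayKernel L α φ x * Complex.exp (φ * Complex.I) /
          (s - x * Complex.exp (φ * Complex.I))) (Ioi 0) := by
  have hre : ∀ x ∈ Ioi (0 : ℝ), s.re ≤ ‖s - x * Complex.exp (φ * Complex.I)‖ := fun x hx =>
    (re_le_re_sub_ray (le_of_lt hx) hφ).trans (Complex.re_le_norm _)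
  refine ((integrableOn_rayKernel hL hα hc).norm.div_const s.re).mono' ?_ ?_
  · have := continuous_rayKernel hα L φ
    refine ContinuousOn.aestronglyMeasurable ?_ measurableSet_Ioi
    refine ContinuousOn.div (by fun_prop) (by fun_prop) fun x hx => ?_
    exact norm_pos_iff.1 (hs.trans_le (hre x hx))
  · filter_upwards [self_mem_ae_restrict measurableSet_Ioi] with x hx
    rw [norm_div, norm_mul, Complex.norm_exp_ofReal_mul_I, mul_one]
    exact div_le_div_of_nonneg_left (norm_nonneg _) hs (hre x hx)

lemma differentiableOn_fractionalDiffusiveDelay {L : ℝ} (hL : 0 < L) (α : ℝ) :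
    DifferentiableOn ℂ (fractionalDiffusiveDelay L α) Complex.slitPlane := by
  intro z hz
  have hz' : (L : ℂ) * z ∈ Complex.slitPlane := by
    rw [Complex.mem_slitPlane_iff] at hz ⊢
    rw [Complex.re_ofReal_mul, Complex.im_ofReal_mul]
    exact hz.imp (mul_pos hL) (mul_ne_zero hL.ne')
  have h := ((differentiableAt_id.const_mul (L : ℂ)).cpow_const (c := (α : ℂ)) hz').neg.cexp
  exact h.differentiableWithinAt

lemma exp_mem_slitPlane_of_abs_im_lt {w : ℂ} (hw : |w.im| < Real.pi) :
    Complex.exp w ∈ Complex.slitPlane := by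
  have h := abs_lt.1 hw
  rw [Complex.mem_slitPlane_iff_arg]
  have h2 : (Complex.exp w).arg = w.im := by
    rw [← Complex.log_im, Complex.log_exp h.1 h.2.le]
  exact ⟨by rw [h2]; exact h.2.ne, Complex.exp_ne_zero w⟩

/-- Cauchy's integral formula for `G = exp (-(L z) ^ α)` in the sector `|arg z| < θ`.
Subtracting `G s (1 + s) / ((1 + z) (s - z))` from `G z / (s - z)` removes the pole at `s` and keeps
the decay at infinity; the difference has equal integrals along the two edges, and the subtracted
term is integrated by `tendsto_integral_rational_ray`. -/
lemma integral_rayKernel_sub_integral_rayKernel_neg {L α θ : ℝ} (hL : 0 < L) (hα : 0 < α)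
    (hθ1 : Real.pi / 2 < θ) (hθ2 : θ < Real.pi) (hc : 0 < Real.cos (α * θ))
    (hαθ : α * θ ≤ Real.pi) {s : ℂ} (hs : 0 < s.re) :
    (∫ x in Ioi (0 : ℝ), rayKernel L α θ x * Complex.exp (θ * Complex.I) /
          (s - x * Complex.exp (θ * Complex.I))) -
      (∫ x in Ioi (0 : ℝ), rayKernel L α (-θ) x * Complex.exp ((-θ : ℝ) * Complex.I) /
          (s - x * Complex.exp ((-θ : ℝ) * Complex.I))) =
      2 * Real.pi * Complex.I * fractionalDiffusiveDelay L α s := by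
  have hpi := Real.pi_pos
  have hs0 : s ≠ 0 := fun h => by simp [h] at hs
  set G := fractionalDiffusiveDelay L α with hG
  set g : ℂ → ℂ := fun z => (1 + z) * G z with hg
  set H : ℂ → ℂ := fun w => dslope g s (Complex.exp w) * (Complex.exp w / (1 + Complex.exp w))
    with hH
  have hsplit : ∀ z : ℂ, z ≠ s → 1 + z ≠ 0 → dslope g s z * (z / (1 + z)) =
      -(G z * z / (s - z)) + G s * ((1 + s) * z / ((1 + z) * (s - z))) := by
    intro z hz hz1
    have h1 : z - s ≠ 0 := sub_ne_zero.2 hz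
    have h2 : s - z ≠ 0 := sub_ne_zero.2 hz.symm
    rw [dslope_of_ne _ hz, slope_def_field]
    simp only [hg]
    field_simp
    ring
  have hpolar : ∀ u φ : ℝ, Complex.exp (u + φ * Complex.I) =
      (Real.exp u : ℂ) * Complex.exp (φ * Complex.I) := fun u φ => by
    rw [Complex.exp_add, Complex.ofReal_exp]
  -- each horizontal edge of the strip, in the limit
  have hedge : ∀ φ σ : ℝ, φ ∈ Ioc (-Real.pi) Real.pi → Real.sin φ ≠ 0 → Real.cos φ ≤ 0 →
      0 < Real.cos (α * φ) → Complex.exp (σ * Complex.I) = -1 → |φ - σ| < Real.pi / 2 →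
      Tendsto (fun R : ℝ => ∫ u in (-R)..R, H (u + φ * Complex.I)) atTop
        (𝓝 (-(∫ x in Ioi (0 : ℝ), rayKernel L α φ x * Complex.exp (φ * Complex.I) /
          (s - x * Complex.exp (φ * Complex.I))) + G s * (σ * Complex.I + Complex.log s))) := by
    intro φ σ hφ hsin hcos hcα hσ hφσ
    have hint := integrableOn_rayKernel_div (φ := φ) hL hα hcα hcos hs
    have h1 := (tendsto_intervalIntegral_exp_smul_comp_exp hint).neg
    have h2 := (tendsto_integral_rational_ray hs hφ hsin hσ hφσ).const_mul (G s)
    refine (h1.add h2).congr fun R => ?_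
    have hne : ∀ u : ℝ, s - (Real.exp u : ℂ) * Complex.exp (φ * Complex.I) ≠ 0 := by
      intro u h0
      have := re_le_re_sub_ray (s := s) (φ := φ) (Real.exp_pos u).le hcos
      rw [h0, Complex.zero_re] at this
      linarith
    have hne1 : ∀ u : ℝ, 1 + (Real.exp u : ℂ) * Complex.exp (φ * Complex.I) ≠ 0 := by
      intro u h0
      have := congrArg Complex.im h0
      rw [Complex.add_im, Complex.im_ofReal_mul, Complex.exp_ofReal_mul_I_im] at this
      simp [hsin] at this
    rw [← intervalIntegral.integral_const_mul, ← intervalIntegral.integral_neg,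
      ← intervalIntegral.integral_add]
    · refine intervalIntegral.integral_congr fun u _ => ?_
      simp only [hH]
      rw [hpolar, hsplit _ (sub_ne_zero.1 (hne u)).symm (hne1 u), hG,
        fractionalDiffusiveDelay_polar hL (Real.exp_pos u) hφ, Complex.real_smul]
      ring
    · exact (integrable_exp_smul_comp_exp hint).neg.intervalIntegrable
    · refine Continuous.intervalIntegrable ?_ _ _
      refine continuous_const.mul (Continuous.div (by fun_prop) (by fun_prop) fun u => ?_)
      exact mul_ne_zero (hne1 u) (hne u)
  -- decay on the vertical edges
  have himle : ∀ y ∈ uIcc (-θ) θ, |y| ≤ θ := fun y hy => by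
    rw [uIcc_of_le (by linarith)] at hy; exact abs_le.2 hy
  have hGnorm : ∀ x y : ℝ, y ∈ uIcc (-θ) θ → ‖G (Complex.exp (x + y * Complex.I))‖ ≤
      Real.exp (-(Real.cos (α * θ) * (L * Real.exp x) ^ α)) := by
    intro x y hy
    have hy' := himle y hy
    have hy2 := abs_le.1 hy'
    rw [hpolar, hG, fractionalDiffusiveDelay_polar hL (Real.exp_pos x)
      ⟨by linarith, by linarith⟩, norm_rayKernel]
    refine Real.exp_le_exp.2 (neg_le_neg (mul_le_mul_of_nonneg_right ?_ (by positivity)))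
    rw [← Real.cos_abs (α * y), abs_mul, abs_of_pos hα]
    exact Real.cos_le_cos_of_nonneg_of_le_pi (by positivity) hαθ
      (mul_le_mul_of_nonneg_left hy' hα.le)
  have hexpnorm : ∀ x y : ℝ, ‖Complex.exp (x + y * Complex.I)‖ = Real.exp x := fun x y => by
    simp [Complex.norm_exp]
  have hHle : ∀ x y A C : ℝ, Complex.exp (x + y * Complex.I) ≠ s →
      1 + Complex.exp (x + y * Complex.I) ≠ 0 → 0 < A → 0 < C →
      A ≤ ‖s - Complex.exp (x + y * Complex.I)‖ → C ≤ ‖1 + Complex.exp (x + y * Complex.I)‖ →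
      ‖H (x + y * Complex.I)‖ ≤ ‖G (Complex.exp (x + y * Complex.I))‖ * Real.exp x / A +
        ‖g s‖ * Real.exp x / (C * A) := by
    intro x y A C h1 h2 hA hC hA' hC'
    simp only [hH]
    rw [hsplit _ h1 h2]
    refine (norm_add_le _ _).trans (add_le_add ?_ ?_)
    · rw [norm_neg, norm_div, norm_mul, hexpnorm]
      exact div_le_div_of_nonneg_left (by positivity) hA hA'
    · have e : G s * ((1 + s) * Complex.exp (x + y * Complex.I) /
          ((1 + Complex.exp (x + y * Complex.I)) * (s - Complex.exp (x + y * Complex.I)))) =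
          g s * Complex.exp (x + y * Complex.I) /
          ((1 + Complex.exp (x + y * Complex.I)) * (s - Complex.exp (x + y * Complex.I))) := by
        simp only [hg]; ring
      rw [e, norm_div, norm_mul (g s), norm_mul (1 + Complex.exp (x + y * Complex.I)), hexpnorm]
      exact div_le_div_of_nonneg_left (by positivity) (by positivity)
        (mul_le_mul hC' hA' hA.le (norm_nonneg _))
  set B : ℝ → ℝ := fun R => (2 * Real.exp (-(Real.cos (α * θ) * (L * Real.exp R) ^ α)) +
    4 * ‖g s‖ * Real.exp (-R)) + (2 + 4 * ‖g s‖) / ‖s‖ * Real.exp (-R) with hBdef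
  have hspos : 0 < ‖s‖ := norm_pos_iff.2 hs0
  have hexp0 : Tendsto (fun R : ℝ => Real.exp (-R)) atTop (𝓝 0) :=
    Real.tendsto_exp_atBot.comp tendsto_neg_atTop_atBot
  -- the first part of `B` bounds the right edge, the last term the left edge
  have hB : Tendsto B atTop (𝓝 0) := by
    have h1 : Tendsto (fun R : ℝ => Real.exp (-(Real.cos (α * θ) * (L * Real.exp R) ^ α)))
        atTop (𝓝 0) :=
      Real.tendsto_exp_atBot.comp (tendsto_neg_atTop_atBot.comp
        (((tendsto_rpow_atTop hα).comp
          (Real.tendsto_exp_atTop.const_mul_atTop hL)).const_mul_atTop hc))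
    simpa using ((h1.const_mul 2).add (hexp0.const_mul (4 * ‖g s‖))).add
      (hexp0.const_mul ((2 + 4 * ‖g s‖) / ‖s‖))
  have hstrip := tendsto_strip_edge_sub_edge (H := H) (c := -θ) (d := θ) (B := B) ?_ hB ?_ ?_
  · have hsinθ : Real.sin θ ≠ 0 := (Real.sin_pos_of_pos_of_lt_pi (by linarith) hθ2).ne'
    have hcosθ : Real.cos θ ≤ 0 :=
      (Real.cos_neg_of_pi_div_two_lt_of_lt hθ1 (by linarith)).le
    have hm := hedge (-θ) (-Real.pi) ⟨by linarith, by linarith⟩ (by simpa using hsinθ)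
      (by simpa using hcosθ) (by simpa using hc)
      (by rw [Complex.ofReal_neg, neg_mul, Complex.exp_neg, Complex.exp_pi_mul_I]; norm_num)
      (by rw [abs_lt]; constructor <;> linarith)
    have hp := hedge θ Real.pi ⟨by linarith, by linarith⟩ hsinθ hcosθ hc
      Complex.exp_pi_mul_I (by rw [abs_lt]; constructor <;> linarith)
    have h := tendsto_nhds_unique hstrip (hm.sub hp)
    push_cast at h ⊢
    linear_combination -h
  · intro w hw
    have hw' : |w.im| < Real.pi := (himle _ hw).trans_lt hθ2
    have hsl := exp_mem_slitPlane_of_abs_im_lt hw'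
    have hgd : DifferentiableOn ℂ g Complex.slitPlane :=
      ((differentiable_const 1).add differentiable_id).differentiableOn.mul
        (differentiableOn_fractionalDiffusiveDelay hL α)
    have hds := (Complex.differentiableOn_dslope
      (Complex.isOpen_slitPlane.mem_nhds (Or.inl hs : s ∈ Complex.slitPlane))).2 hgd
    have hd := (hds.differentiableAt (Complex.isOpen_slitPlane.mem_nhds hsl)).comp w
      Complex.differentiableAt_exp
    refine hd.mul (Complex.differentiableAt_exp.div (by fun_prop) ?_)
    intro h0
    have h1 : Complex.exp w = -1 := by linear_combination h0
    rw [h1] at hsl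
    norm_num [Complex.mem_slitPlane_iff] at hsl
  · filter_upwards [Real.tendsto_exp_atTop.eventually_ge_atTop (2 * ‖s‖ + 2)] with R hR y hy
    have hx := Real.exp_pos R
    have hA : Real.exp R / 2 ≤ ‖s - Complex.exp (R + y * Complex.I)‖ := by
      have := norm_sub_norm_le (Complex.exp (R + y * Complex.I)) s
      rw [hexpnorm, norm_sub_rev] at this
      linarith
    have hC : Real.exp R / 2 ≤ ‖1 + Complex.exp (R + y * Complex.I)‖ := by
      have := norm_sub_le (1 + Complex.exp (R + y * Complex.I)) 1
      rw [add_sub_cancel_left, hexpnorm, norm_one] at this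
      linarith
    have hA0 : 0 < Real.exp R / 2 := by positivity
    refine (hHle R y _ _ ?_ ?_ hA0 hA0 hA hC).trans ?_
    · exact fun h => by rw [h, sub_self, norm_zero] at hA; linarith
    · exact fun h => by rw [h, norm_zero] at hC; linarith
    · have e1 : ‖G (Complex.exp (R + y * Complex.I))‖ * Real.exp R / (Real.exp R / 2) =
        2 * ‖G (Complex.exp (R + y * Complex.I))‖ := by field_simp
      have e2 : ‖g s‖ * Real.exp R / (Real.exp R / 2 * (Real.exp R / 2)) =
        4 * ‖g s‖ * Real.exp (-R) := by rw [Real.exp_neg]; field_simp; norm_num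
      rw [e1, e2]
      refine le_add_of_le_of_nonneg (add_le_add_left ?_ _) (by positivity)
      exact mul_le_mul_of_nonneg_left (hGnorm R y hy) (by norm_num)
  · filter_upwards [hexp0.eventually (gt_mem_nhds (show (0 : ℝ) < 1 / 2 by norm_num)),
      hexp0.eventually (gt_mem_nhds (half_pos hspos))] with R hR1 hR2 y hy
    have hA : ‖s‖ / 2 ≤ ‖s - Complex.exp ((-R : ℝ) + y * Complex.I)‖ := by
      have := norm_sub_norm_le s (Complex.exp ((-R : ℝ) + y * Complex.I))
      rw [hexpnorm] at this
      linarith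
    have hC : (1 / 2 : ℝ) ≤ ‖1 + Complex.exp ((-R : ℝ) + y * Complex.I)‖ := by
      have := norm_sub_le (1 + Complex.exp ((-R : ℝ) + y * Complex.I))
        (Complex.exp ((-R : ℝ) + y * Complex.I))
      rw [add_sub_cancel_right, hexpnorm, norm_one] at this
      linarith
    have hA0 : 0 < ‖s‖ / 2 := by positivity
    refine (hHle (-R) y _ _ ?_ ?_ hA0 (by norm_num) hA hC).trans ?_
    · exact fun h => by rw [h, sub_self, norm_zero] at hA; linarith
    · exact fun h => by rw [h, norm_zero] at hC; linarith
    · have hG1 : ‖G (Complex.exp ((-R : ℝ) + y * Complex.I))‖ ≤ 1 :=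
        (hGnorm (-R) y hy).trans (Real.exp_le_one_iff.2 (neg_nonpos.2 (by positivity)))
      have e : (2 + 4 * ‖g s‖) / ‖s‖ * Real.exp (-R) = 1 * Real.exp (-R) / (‖s‖ / 2) +
          ‖g s‖ * Real.exp (-R) / (1 / 2 * (‖s‖ / 2)) := by field_simp; ring
      simp only [hBdef]
      refine le_add_of_nonneg_of_le (by positivity) ?_
      rw [e]
      gcongr

lemma isImpulseResponse_fddResponse {L α : ℝ} (hL : 0 < L) (hα : 0 < α) (hα1 : α < 1) :
    IsImpulseResponse (fun t => (fddResponse L α t : ℂ)) (fractionalDiffusiveDelay L α) := by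
  refine ⟨0, fun s hs => ?_⟩
  obtain ⟨h1, h2, h3⟩ := rayAngle_bounds hα hα1
  obtain ⟨hc1, hc2⟩ := cos_rayAngle hα hα1
  obtain ⟨ip, lp⟩ := laplace_rayIntegral (φ := rayAngle α) hL hα hc2 hc1.le hs
  obtain ⟨im, lm⟩ := laplace_rayIntegral (φ := -rayAngle α) hL hα
    (by rwa [mul_neg, Real.cos_neg]) (by rw [Real.cos_neg]; exact hc1.le) hs
  have hcong : EqOn (fun t : ℝ => Complex.exp (-(s * t)) * (fddResponse L α t : ℂ))
      (fun t : ℝ => (Complex.exp (-(s * t)) * rayIntegral L α (rayAngle α) t -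
        Complex.exp (-(s * t)) * rayIntegral L α (-rayAngle α) t) /
        (2 * Real.pi * Complex.I)) (Ioi 0) := by
    intro t ht
    simp only
    rw [ofReal_fddResponse hL hα hα1 ht]
    ring
  refine ⟨IntegrableOn.congr_fun ((ip.sub im).div_const _) hcong.symm measurableSet_Ioi, ?_⟩
  rw [setIntegral_congr_fun measurableSet_Ioi hcong, integral_div, integral_sub ip im, lp, lm,
    integral_rayKernel_sub_integral_rayKernel_neg hL hα h1 h2 hc2
      (by rw [h3]; linarith [Real.pi_pos]) hs]
  have := Complex.ofReal_ne_zero.2 Real.pi_ne_zero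
  field_simp [Complex.I_ne_zero]

/-! ### Uniqueness of the inverse Laplace transform -/

/-- Injectivity of the Fourier transform on `L¹(ℝ)`: it is self-adjoint and every test function is the
Fourier transform of a Schwartz function. -/
lemma ae_eq_zero_of_fourier_eq_zero {h : ℝ → ℂ} (hh : Integrable h) (h0 : ∀ ξ, 𝓕 h ξ = 0) :
    ∀ᵐ x, h x = 0 := by
  refine ae_eq_zero_of_integral_contDiff_smul_eq_zero hh.locallyIntegrable fun g hg hgc => ?_
  have hgc' : HasCompactSupport (fun x => (g x : ℂ)) := hgc.comp_left Complex.ofReal_zero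
  set G : 𝓢(ℝ, ℂ) := hgc'.toSchwartzMap (Complex.ofRealCLM.contDiff.comp hg)
  set k : 𝓢(ℝ, ℂ) := 𝓕⁻ G with hk
  have hG : ∀ x, 𝓕 (k : ℝ → ℂ) x = (g x : ℂ) := by
    intro x
    have : 𝓕 k = G := FourierTransform.fourier_fourierInv_eq G
    rw [← SchwartzMap.fourier_coe, this]
    rfl
  have key := VectorFourier.integral_fourierIntegral_smul_eq_flip (L := innerₗ ℝ)
    (μ := volume) (ν := volume) Real.continuous_fourierChar continuous_inner k.integrable hh
  have e1 : ∀ ξ, VectorFourier.fourierIntegral Real.fourierChar volume (innerₗ ℝ).flip h ξ = 0 := by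
    intro ξ
    rw [flip_innerₗ]
    exact h0 ξ
  have e2 : ∀ ξ, VectorFourier.fourierIntegral Real.fourierChar volume (innerₗ ℝ) k ξ = (g ξ : ℂ) :=
    hG
  simp only [e1, e2, smul_zero, integral_zero] at key
  simpa using key

/-- The function `e ^ (-b t) f t` on `(0, ∞)`, extended by `0`. Its Fourier transform is the Laplace
transform of `f` on the line `Re s = b`. -/
def dampedZeroExtension (f : ℝ → ℂ) (b : ℝ) : ℝ → ℂ :=
  (Ioi (0 : ℝ)).indicator fun t => Complex.exp (-((b : ℂ) * t)) * f t

lemma fourier_dampedZeroExtension (f : ℝ → ℂ) (b ξ : ℝ) :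
    𝓕 (dampedZeroExtension f b) ξ = ∫ t in Ioi (0 : ℝ),
      Complex.exp (-(((b : ℂ) + (2 * Real.pi * ξ : ℝ) * Complex.I) * t)) * f t := by
  rw [Real.fourier_real_eq_integral_exp_smul, ← integral_indicator measurableSet_Ioi]
  congr 1
  ext t
  by_cases ht : t ∈ Ioi (0 : ℝ)
  · rw [dampedZeroExtension, indicator_of_mem ht, indicator_of_mem ht, smul_eq_mul, ← mul_assoc,
      ← Complex.exp_add]
    congr 2; push_cast; ring
  · rw [dampedZeroExtension, indicator_of_notMem ht, indicator_of_notMem ht, smul_zero]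

/-- Uniqueness of the inverse Laplace transform. On a vertical line in the common half-plane of
convergence the Laplace transform of `f - r` is a Fourier transform. -/
lemma IsImpulseResponse.ae_eq {f r : ℝ → ℂ} {G : ℂ → ℂ} (hf : IsImpulseResponse f G)
    (hr : IsImpulseResponse r G) : ∀ᵐ t ∂(volume.restrict (Ioi (0 : ℝ))), f t = r t := by
  obtain ⟨c, hc⟩ := hf
  obtain ⟨d, hd⟩ := hr
  set b : ℝ := max c d + 1 with hb
  have hbc : c < b := (le_max_left c d).trans_lt (lt_add_one _)
  have hbd : d < b := (le_max_right c d).trans_lt (lt_add_one _)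
  have hint : Integrable (dampedZeroExtension (fun t => f t - r t) b) := by
    refine (integrable_indicator_iff measurableSet_Ioi).2 ?_
    have h := (hc b (by simpa using hbc)).1.sub (hd b (by simpa using hbd)).1
    refine h.congr (Eventually.of_forall fun t => ?_)
    simp [mul_sub]
  have h0 := ae_eq_zero_of_fourier_eq_zero hint fun ξ => by
    rw [fourier_dampedZeroExtension]
    have h1 := hc ((b : ℂ) + (2 * Real.pi * ξ : ℝ) * Complex.I) (by simpa using hbc)
    have h2 := hd ((b : ℂ) + (2 * Real.pi * ξ : ℝ) * Complex.I) (by simpa using hbd)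
    simp_rw [mul_sub]
    rw [integral_sub h1.1 h2.1, h1.2, h2.2, sub_self]
  rw [ae_restrict_iff' measurableSet_Ioi]
  filter_upwards [h0] with t ht htpos
  rw [dampedZeroExtension, indicator_of_mem htpos] at ht
  exact sub_eq_zero.1 ((mul_eq_zero.1 ht).resolve_left (Complex.exp_ne_zero _))

lemma IsImpulseResponse.congr_ae {f r : ℝ → ℂ} {G : ℂ → ℂ} (hr : IsImpulseResponse r G)
    (h : ∀ᵐ t ∂(volume.restrict (Ioi (0 : ℝ))), f t = r t) : IsImpulseResponse f G := by
  obtain ⟨c, hc⟩ := hr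
  refine ⟨c, fun s hs => ?_⟩
  have h' : (fun t : ℝ => Complex.exp (-(s * t)) * f t) =ᵐ[volume.restrict (Ioi (0 : ℝ))]
      fun t : ℝ => Complex.exp (-(s * t)) * r t := by
    filter_upwards [h] with t ht
    rw [ht]
  exact ⟨(hc s hs).1.congr h'.symm, (integral_congr_ae h').trans (hc s hs).2⟩

/-! ### Exponents without an impulse response -/

/-- Riemann–Lebesgue lemma: a Laplace transform tends to `0` along vertical lines. -/
lemma IsImpulseResponse.tendsto_vertical {f : ℝ → ℂ} {G : ℂ → ℂ} (hf : IsImpulseResponse f G) :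
    ∃ c : ℝ, ∀ b : ℝ, c < b →
      Tendsto (fun y : ℝ => G ((b : ℂ) + y * Complex.I)) atTop (𝓝 0) := by
  obtain ⟨c, hc⟩ := hf
  refine ⟨c, fun b hb => ?_⟩
  have h := (Real.zero_at_infty_fourier (dampedZeroExtension f b)).mono_left atTop_le_cocompact
  have h2 := h.comp (tendsto_id.atTop_div_const (show (0 : ℝ) < 2 * Real.pi by positivity))
  refine h2.congr fun y => ?_
  have e : 2 * Real.pi * (y / (2 * Real.pi)) = y := by field_simp
  rw [Function.comp_apply, fourier_dampedZeroExtension, id, e]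
  exact (hc _ (by simpa using hb)).2

/-- A Laplace transform is bounded on some right half-plane. -/
lemma IsImpulseResponse.exists_norm_le {f : ℝ → ℂ} {G : ℂ → ℂ} (hf : IsImpulseResponse f G) :
    ∃ b M : ℝ, ∀ s : ℂ, b ≤ s.re → ‖G s‖ ≤ M := by
  obtain ⟨c, hc⟩ := hf
  refine ⟨c + 1, ∫ t in Ioi (0 : ℝ), ‖Complex.exp (-(((c + 1 : ℝ) : ℂ) * t)) * f t‖, fun s hs => ?_⟩
  have h1 := hc s (by linarith)
  have h2 := hc ((c + 1 : ℝ) : ℂ) (by simp)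
  rw [← h1.2]
  refine (norm_integral_le_integral_norm _).trans
    (setIntegral_mono_on h1.1.norm h2.1.norm measurableSet_Ioi fun t ht => ?_)
  rw [norm_mul, norm_mul, Complex.norm_exp, Complex.norm_exp]
  refine mul_le_mul_of_nonneg_right (Real.exp_le_exp.2 ?_) (norm_nonneg _)
  rw [Complex.neg_re, Complex.neg_re, Complex.re_mul_ofReal, Complex.re_mul_ofReal,
    Complex.ofReal_re]
  exact neg_le_neg (mul_le_mul_of_nonneg_right hs (le_of_lt ht))

lemma norm_fractionalDiffusiveDelay (L α : ℝ) (s : ℂ) :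
    ‖fractionalDiffusiveDelay L α s‖ = Real.exp (-(((L : ℂ) * s) ^ (α : ℂ)).re) := by
  rw [fractionalDiffusiveDelay, Complex.norm_exp, Complex.neg_re]

/-- If `Re ((L s) ^ α)` is bounded above on vertical lines, `|exp (-(L s) ^ α)|` is bounded away from `0`
there, against the Riemann–Lebesgue lemma. -/
lemma not_isImpulseResponse_of_re_le {L α : ℝ}
    (h : ∀ b : ℝ, 0 < b → ∃ M : ℝ, ∀ y : ℝ,
      (((L : ℂ) * ((b : ℂ) + y * Complex.I)) ^ (α : ℂ)).re ≤ M) (f : ℝ → ℂ) :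
    ¬ IsImpulseResponse f (fractionalDiffusiveDelay L α) := by
  intro hf
  obtain ⟨c, hc⟩ := hf.tendsto_vertical
  have hb : c < max c 0 + 1 := (le_max_left c 0).trans_lt (lt_add_one _)
  have hb0 : 0 < max c 0 + 1 := (le_max_right c 0).trans_lt (lt_add_one _)
  obtain ⟨M, hM⟩ := h _ hb0
  have hlim := (hc _ hb).norm
  rw [norm_zero] at hlim
  have := ge_of_tendsto hlim (Eventually.of_forall fun y => ?_) (b := Real.exp (-M))
  · exact absurd this (not_le.2 (Real.exp_pos _))
  · rw [norm_fractionalDiffusiveDelay]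
    exact Real.exp_le_exp.2 (neg_le_neg (hM y))

lemma not_isImpulseResponse_of_nonpos {L α : ℝ} (hL : 0 < L) (hα : α ≤ 0) (f : ℝ → ℂ) :
    ¬ IsImpulseResponse f (fractionalDiffusiveDelay L α) := by
  refine not_isImpulseResponse_of_re_le (fun b hb => ⟨(L * b) ^ α, fun y => ?_⟩) f
  have hre : L * b ≤ ‖(L : ℂ) * ((b : ℂ) + y * Complex.I)‖ := by
    have := Complex.re_le_norm ((L : ℂ) * ((b : ℂ) + y * Complex.I))
    simpa using this
  have hpos : 0 < L * b := mul_pos hL hb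
  refine (Complex.re_le_norm _).trans ?_
  rw [Complex.norm_cpow_of_ne_zero (norm_pos_iff.1 (hpos.trans_le hre))]
  simpa using Real.rpow_le_rpow_of_nonpos hpos hre hα

lemma not_isImpulseResponse_one {L : ℝ} (f : ℝ → ℂ) :
    ¬ IsImpulseResponse f (fractionalDiffusiveDelay L 1) :=
  not_isImpulseResponse_of_re_le (fun b _ => ⟨L * b, fun y => by simp⟩) f

/-- For `α > 1` there is a ray in the right half-plane along which `cos (α * arg s) < 0`, so that
`|exp (-(L s) ^ α)|` is unbounded on every right half-plane. -/
lemma not_isImpulseResponse_of_one_lt {L α : ℝ} (hL : 0 < L) (hα : 1 < α) (f : ℝ → ℂ) :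
    ¬ IsImpulseResponse f (fractionalDiffusiveDelay L α) := by
  intro hf
  obtain ⟨b, M, hM⟩ := hf.exists_norm_le
  have hpi := Real.pi_pos
  have hα0 : 0 < α := by linarith
  -- `χ` is the argument of `s ^ α`: `cos χ < 0`, and `arg s = χ / α` is still less than `π / 2`
  obtain ⟨χ, hχ1, hχ2⟩ : ∃ χ, Real.pi / 2 < χ ∧ χ < min Real.pi (α * (Real.pi / 2)) :=
    exists_between (lt_min (by linarith) (by nlinarith))
  have hχ3 := hχ2.trans_le (min_le_left _ _)
  have hχ4 := hχ2.trans_le (min_le_right _ _)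
  set ψ := χ / α with hψ
  have hαψ : α * ψ = χ := by rw [hψ]; field_simp
  have hψ0 : 0 < ψ := div_pos (by linarith) hα0
  have hψ1 : ψ < Real.pi / 2 := by rw [hψ, div_lt_iff₀ hα0]; linarith
  have hcosψ : 0 < Real.cos ψ := Real.cos_pos_of_mem_Ioo ⟨by linarith, hψ1⟩
  have hcosχ : Real.cos χ < 0 := Real.cos_neg_of_pi_div_two_lt_of_lt hχ1 (by linarith)
  have hgrow : Tendsto (fun x : ℝ => Real.exp (-Real.cos χ * (L * x) ^ α)) atTop atTop :=
    Real.tendsto_exp_atTop.comp (((tendsto_rpow_atTop hα0).comp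
      (tendsto_id.const_mul_atTop hL)).const_mul_atTop (neg_pos.2 hcosχ))
  have hre : Tendsto (fun x : ℝ => x * Real.cos ψ) atTop atTop :=
    tendsto_id.atTop_mul_const hcosψ
  obtain ⟨x, h1, h2, h3⟩ := ((hgrow.eventually_gt_atTop M).and
    ((hre.eventually_ge_atTop b).and (eventually_gt_atTop 0))).exists
  have h4 := hM (x * Complex.exp (ψ * Complex.I))
    (by rwa [Complex.re_ofReal_mul, Complex.exp_ofReal_mul_I_re])
  rw [fractionalDiffusiveDelay_polar hL h3 ⟨by linarith, by linarith⟩, norm_rayKernel, hαψ,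
    ← neg_mul] at h4
  linarith

end

end

theorem lemma1 (L : ℝ) (hL : 0 < L) (α : ℝ) :
    ((∃ f : ℝ → ℂ, IsImpulseResponse f (fractionalDiffusiveDelay L α)) ↔ α ∈ Ioo (0 : ℝ) 1) ∧
    (α ∈ Ioo (0 : ℝ) 1 →
      ∃ r : ℝ → ℝ,
        (∀ t : ℝ, 0 < t → HasSum (fun i : ℕ => fddTerm L α t i) (r t)) ∧
        (∀ t : ℝ, 0 < t →
          (r t : ℂ) = wrightFunction (-α) 0 ((-(L ^ α * t ^ (-α)) : ℝ) : ℂ) / (t : ℂ)) ∧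
        ContinuousOn r (Ioi 0) ∧
        ∀ f : ℝ → ℂ, IsImpulseResponse f (fractionalDiffusiveDelay L α) ↔
          ∀ᵐ t ∂(volume.restrict (Ioi (0 : ℝ))), f t = (r t : ℂ)) := by
  refine ⟨⟨?_, fun h => ⟨_, isImpulseResponse_fddResponse hL h.1 h.2⟩⟩, fun h =>
    ⟨fddResponse L α, fun t ht => hasSum_fddTerm hL h.1 h.2 ht,
      fun t ht => fddResponse_eq_wrightFunction ht, continuousOn_fddResponse hL h.1 h.2,
      fun f => ⟨fun hf => hf.ae_eq (isImpulseResponse_fddResponse hL h.1 h.2),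
        fun hf => (isImpulseResponse_fddResponse hL h.1 h.2).congr_ae hf⟩⟩⟩
  rintro ⟨f, hf⟩
  by_contra hα
  rcases le_or_gt α 0 with h0 | h0
  · exact not_isImpulseResponse_of_nonpos hL h0 f hf
  rcases lt_trichotomy α 1 with h1 | rfl | h1
  · exact hα ⟨h0, h1⟩
  · exact not_isImpulseResponse_one f hf
  · exact not_isImpulseResponse_of_one_lt hL h1 f hf
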